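/- Let $d \ge 0$ and let $\mu$ be a complex (in particular, possibly signed) Radon measure on $\mathbb{R}^d$, possibly unbounded, that is, a linear functional on $C_{\mathsf c}(\mathbb{R}^d)=C_{\mathsf c}(\mathbb{R}^d,\mathbb{C})$ such that for every compact $K\subset\mathbb{R}^d$ there is a constant $C_K$ with $|\mu(\varphi)|\le C_K\|\varphi\|_\infty$ for all $\varphi \in C_{\mathsf c}(\mathbb{R}^d)$ supported in $K$. Let $|\mu|$ be its total variation, the positive Radon measure with $|\mu|(f)=\sup\{|\mu(g)| : g\in C_{\mathsf c}(\mathbb{R}^d),\ |g|\le f\}$ for $0\le f\in C_{\mathsf c}(\mathbb{R}^d)$. For $f\in L^1(|\mu|)$, let $\int f\,\mathrm{d}\mu$ be the value at $f$ of the continuous extension of $\mu$ from $C_{\mathsf c}(\mathbb{R}^d)$ to $L^1(|\mu|)$. Let $\mathcal{S}(\mathbb{R}^d)$ be the space of complex-valued Schwartz functions and $\mathcal{S}'(\mathbb{R}^d)$ the space of tempered distributions. A Radon measure $\mu$ is called * tempered if there is a $T\in\mathcal{S}'(\mathbb{R}^d)$ with $\mu(\varphi)=T(\varphi)$ for all $\varphi\in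 C^\infty_{\mathsf c}(\mathbb{R}^d)$; * strongly tempered if $|\psi|\in L^1(|\mu|)$ for all $\psi\in\mathcal{S}(\mathbb{R}^d)$ and $\psi\mapsto\int_{\mathbb{R}^d}\psi\,\mathrm{d}\mu$ is a tempered distribution; * slowly increasing if $\int_{\mathbb{R}^d}\frac{\mathrm{d}|\mu|(x)}{1+|P(x)|}<\infty$ for some polynomial $P\in\mathbb{C}[x_1,\dots,x_d]$. Theorem. For every complex Radon measure $\mu$ on $\mathbb{R}^d$, the following properties are equivalent: 1. $\mu$ is slowly increasing; 2. $|\mu|$ is strongly tempered; 3. $|\mu|$ is tempered; 4. $|\psi|\in L^1(|\mu|)$ for all $\psi\in\mathcal{S}(\mathbb{R}^d)$; 5. $\mu$ is strongly tempered. Further, if $\mu$ is strongly tempered, then it is tempered. The converse need not hold: for every $d\ge 1$ there is a complex Radon measure on $\mathbb{R}^d$ that is tempered but not strongly tempered. -/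

import Mathlib

open MeasureTheory Filter Topology CompactlySupported SchwartzMap
open scoped NNReal ContDiff

noncomputable section

/-- A general (signed or complex, possibly unbounded) Radon measure on `ℝ^d`: a linear functional
on `C_c(ℝ^d, ℂ)` that is continuous for the inductive limit topology, that is, for every compact
`K` it is bounded in the sup norm on the functions supported in `K`. -/
structure ComplexRadonMeasure (d : ℕ) where
  toLinearMap : C_c(EuclideanSpace ℝ (Fin d), ℂ) →ₗ[ℂ] ℂ
  bounded_on_compact : ∀ K : Set (EuclideanSpace ℝ (Fin d)), IsCompact K →
    ∃ C : ℝ, ∀ (φ : C_c(EuclideanSpace ℝ (Fin d), ℂ)) (M : ℝ),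
      tsupport φ ⊆ K → (∀ x, ‖φ x‖ ≤ M) → ‖toLinearMap φ‖ ≤ C * M

namespace ComplexRadonMeasure

variable {d : ℕ}

instance : CoeFun (ComplexRadonMeasure d)
    (fun _ => C_c(EuclideanSpace ℝ (Fin d), ℂ) → ℂ) :=
  ⟨fun μ => μ.toLinearMap⟩

/-- The total variation on nonnegative functions: `|μ|(f) = sup { |μ(g)| : |g| ≤ f }`. -/
def absFun (μ : ComplexRadonMeasure d) (f : C_c(EuclideanSpace ℝ (Fin d), ℝ≥0)) : ℝ≥0 :=
  ⨆ g : {g : C_c(EuclideanSpace ℝ (Fin d), ℂ) // ∀ x, ‖g x‖₊ ≤ f x}, ‖μ g.1‖₊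

theorem bddAbove_absFun (μ : ComplexRadonMeasure d) (f : C_c(EuclideanSpace ℝ (Fin d), ℝ≥0)) :
    BddAbove (Set.range fun g : {g : C_c(EuclideanSpace ℝ (Fin d), ℂ) // ∀ x, ‖g x‖₊ ≤ f x} =>
      ‖μ g.1‖₊) := by
  obtain ⟨C, hC⟩ := μ.bounded_on_compact (tsupport f) f.hasCompactSupport
  obtain ⟨M, hM⟩ := (f.hasCompactSupport.isCompact_range f.continuous).bddAbove
  refine ⟨(C * M).toNNReal, ?_⟩
  rintro _ ⟨⟨g, hg⟩, rfl⟩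
  have h : ‖μ g‖ ≤ C * M := by
    refine hC g M (closure_mono fun x hx => ?_) fun x => ?_
    · intro h0
      have := hg x
      rw [h0, nonpos_iff_eq_zero, nnnorm_eq_zero] at this
      exact hx this
    · exact_mod_cast (hg x).trans (hM ⟨x, rfl⟩)
  exact NNReal.le_toNNReal_of_coe_le h

theorem le_absFun (μ : ComplexRadonMeasure d) {f : C_c(EuclideanSpace ℝ (Fin d), ℝ≥0)}
    {g : C_c(EuclideanSpace ℝ (Fin d), ℂ)} (hg : ∀ x, ‖g x‖₊ ≤ f x) : ‖μ g‖₊ ≤ μ.absFun f :=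
  le_ciSup (μ.bddAbove_absFun f) ⟨g, hg⟩

theorem absFun_le (μ : ComplexRadonMeasure d) {f : C_c(EuclideanSpace ℝ (Fin d), ℝ≥0)}
    {a : ℝ≥0} (h : ∀ g : C_c(EuclideanSpace ℝ (Fin d), ℂ), (∀ x, ‖g x‖₊ ≤ f x) → ‖μ g‖₊ ≤ a) :
    μ.absFun f ≤ a := by
  have : Nonempty {g : C_c(EuclideanSpace ℝ (Fin d), ℂ) // ∀ x, ‖g x‖₊ ≤ f x} :=
    ⟨⟨0, fun x => by simp⟩⟩
  exact ciSup_le fun g => h g.1 g.2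

theorem exists_split (f₁ f₂ : C_c(EuclideanSpace ℝ (Fin d), ℝ≥0))
    (h : C_c(EuclideanSpace ℝ (Fin d), ℂ)) (hh : ∀ x, ‖h x‖₊ ≤ (f₁ + f₂) x) :
    ∃ h₁ h₂ : C_c(EuclideanSpace ℝ (Fin d), ℂ), h = h₁ + h₂ ∧
      (∀ x, ‖h₁ x‖₊ ≤ f₁ x) ∧ ∀ x, ‖h₂ x‖₊ ≤ f₂ x := by
  have key : ∀ k l : C_c(EuclideanSpace ℝ (Fin d), ℝ≥0),
      (∀ x, ‖h x‖ ≤ (k x : ℝ) + l x) →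
      ∃ u : C_c(EuclideanSpace ℝ (Fin d), ℂ), (∀ x, ‖u x‖₊ ≤ k x) ∧
        ∀ x, u x = (((k x : ℝ) / ((k x : ℝ) + l x) : ℝ) : ℂ) * h x := by
    intro k l hkl
    have hb : ∀ x, ‖(((k x : ℝ) / ((k x : ℝ) + l x) : ℝ) : ℂ) * h x‖ ≤ k x := by
      intro x
      rw [norm_mul, Complex.norm_real, Real.norm_of_nonneg (by positivity)]
      rcases eq_or_lt_of_le (show (0 : ℝ) ≤ (k x : ℝ) + l x by positivity) with h0 | h0
      · simp [← h0]
      · calc _ ≤ (k x : ℝ) / ((k x : ℝ) + l x) * ((k x : ℝ) + l x) := by gcongr; exact hkl x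
          _ = k x := by field_simp
    have hk : Continuous fun x => (k x : ℝ) := NNReal.continuous_coe.comp k.continuous
    have hl : Continuous fun x => (l x : ℝ) := NNReal.continuous_coe.comp l.continuous
    have hc : Continuous fun x => (((k x : ℝ) / ((k x : ℝ) + l x) : ℝ) : ℂ) * h x := by
      rw [continuous_iff_continuousAt]
      intro x
      by_cases h0 : (k x : ℝ) + l x = 0
      · have hkx : (k x : ℝ) = 0 := by
          have h1 : (0 : ℝ) ≤ k x := (k x).2
          have h2 : (0 : ℝ) ≤ l x := (l x).2
          linarith
        rw [ContinuousAt, h0, div_zero, Complex.ofReal_zero, zero_mul]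
        refine squeeze_zero_norm hb ?_
        have := hk.tendsto x
        rwa [hkx] at this
      · exact (Complex.continuous_ofReal.continuousAt.comp
          (hk.continuousAt.div (hk.add hl).continuousAt h0)).mul h.continuous.continuousAt
    exact ⟨⟨⟨_, hc⟩, h.hasCompactSupport.mul_left⟩, fun x => by exact_mod_cast hb x,
      fun x => rfl⟩
  have hh' : ∀ x, ‖h x‖ ≤ (f₁ x : ℝ) + f₂ x := fun x => by exact_mod_cast hh x
  obtain ⟨u, hu, hu'⟩ := key f₁ f₂ hh'
  obtain ⟨v, hv, hv'⟩ := key f₂ f₁ fun x => by rw [add_comm]; exact hh' x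
  refine ⟨u, v, ?_, hu, hv⟩
  ext x
  rw [CompactlySupportedContinuousMap.add_apply, hu', hv', ← add_mul, ← Complex.ofReal_add]
  by_cases h0 : (f₁ x : ℝ) + f₂ x = 0
  · have : h x = 0 := norm_le_zero_iff.1 ((hh' x).trans h0.le)
    simp [this]
  · rw [add_comm (f₂ x : ℝ), ← add_div, div_self h0]
    simp

theorem absFun_add (μ : ComplexRadonMeasure d) (f₁ f₂ : C_c(EuclideanSpace ℝ (Fin d), ℝ≥0)) :
    μ.absFun (f₁ + f₂) = μ.absFun f₁ + μ.absFun f₂ := by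
  apply le_antisymm
  · refine μ.absFun_le fun g hg => ?_
    obtain ⟨h₁, h₂, rfl, hh₁, hh₂⟩ := exists_split f₁ f₂ g hg
    rw [map_add]
    exact (nnnorm_add_le _ _).trans (add_le_add (μ.le_absFun hh₁) (μ.le_absFun hh₂))
  · have unim : ∀ z : ℂ, ∃ c : ℂ, ‖c‖₊ = 1 ∧ c * z = (‖z‖ : ℂ) := by
      intro z
      by_cases hz : z = 0
      · exact ⟨1, by simp, by simp [hz]⟩
      · have hz' : (‖z‖ : ℂ) ≠ 0 := by simpa using hz
        refine ⟨(‖z‖ : ℂ) / z, ?_, by field_simp⟩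
        ext
        simp [hz]
    have : ∀ g₁ g₂ : C_c(EuclideanSpace ℝ (Fin d), ℂ), (∀ x, ‖g₁ x‖₊ ≤ f₁ x) →
        (∀ x, ‖g₂ x‖₊ ≤ f₂ x) → ‖μ g₁‖₊ + ‖μ g₂‖₊ ≤ μ.absFun (f₁ + f₂) := by
      intro g₁ g₂ h₁ h₂
      obtain ⟨c₁, hc₁, e₁⟩ := unim (μ g₁)
      obtain ⟨c₂, hc₂, e₂⟩ := unim (μ g₂)
      have hle := μ.le_absFun (f := f₁ + f₂) (g := c₁ • g₁ + c₂ • g₂) fun x => by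
        simp only [CompactlySupportedContinuousMap.add_apply,
          CompactlySupportedContinuousMap.smul_apply, smul_eq_mul]
        refine (nnnorm_add_le _ _).trans ?_
        rw [nnnorm_mul, nnnorm_mul, hc₁, hc₂, one_mul, one_mul]
        exact add_le_add (h₁ x) (h₂ x)
      rw [map_add, map_smul, map_smul, smul_eq_mul, smul_eq_mul, e₁, e₂, ← Complex.ofReal_add]
        at hle
      refine le_trans (le_of_eq ?_) hle
      ext
      rw [coe_nnnorm, Complex.norm_real, Real.norm_of_nonneg (by positivity)]
      simp
    have step : ∀ g₁ : C_c(EuclideanSpace ℝ (Fin d), ℂ), (∀ x, ‖g₁ x‖₊ ≤ f₁ x) →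
        ‖μ g₁‖₊ + μ.absFun f₂ ≤ μ.absFun (f₁ + f₂) := by
      intro g₁ h₁
      rw [add_comm]
      refine add_le_of_le_tsub_right_of_le ?_ ?_
      · exact le_self_add.trans (this g₁ 0 h₁ (by simp))
      · refine μ.absFun_le fun g₂ h₂ => le_tsub_of_add_le_right ?_
        rw [add_comm]
        exact this g₁ g₂ h₁ h₂
    refine add_le_of_le_tsub_right_of_le ?_ ?_
    · simpa using step 0 (by simp)
    · exact μ.absFun_le fun g₁ h₁ => le_tsub_of_add_le_right (step g₁ h₁)

theorem absFun_smul (μ : ComplexRadonMeasure d) (c : ℝ≥0)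
    (f : C_c(EuclideanSpace ℝ (Fin d), ℝ≥0)) : μ.absFun (c • f) = c * μ.absFun f := by
  have key : ∀ (c : ℝ≥0), c ≠ 0 → ∀ f : C_c(EuclideanSpace ℝ (Fin d), ℝ≥0),
      μ.absFun (c • f) ≤ c * μ.absFun f := by
    intro c hc f
    refine μ.absFun_le fun g hg => ?_
    have h := μ.le_absFun (f := f) (g := ((c⁻¹ : ℝ≥0) : ℂ) • g) fun x => by
      rw [CompactlySupportedContinuousMap.smul_apply, nnnorm_smul]
      have := hg x
      rw [CompactlySupportedContinuousMap.smul_apply, smul_eq_mul] at this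
      have hn : ‖((c⁻¹ : ℝ≥0) : ℂ)‖₊ = c⁻¹ := by ext; simp
      rw [hn, inv_mul_le_iff₀ (pos_iff_ne_zero.2 hc)]
      exact this
    have hn : ‖((c⁻¹ : ℝ≥0) : ℂ)‖₊ = c⁻¹ := by ext; simp
    rw [map_smul, nnnorm_smul, hn, inv_mul_le_iff₀ (pos_iff_ne_zero.2 hc)] at h
    exact h
  by_cases hc : c = 0
  · subst hc
    rw [zero_smul, zero_mul, ← nonpos_iff_eq_zero]
    refine μ.absFun_le fun g hg => ?_
    have : g = 0 := by
      ext x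
      simpa using hg x
    simp [this]
  · refine le_antisymm (key c hc f) ?_
    have := key c⁻¹ (inv_ne_zero hc) (c • f)
    rwa [smul_smul, inv_mul_cancel₀ hc, one_smul, le_inv_mul_iff₀ (pos_iff_ne_zero.2 hc)] at this

/-- The total variation `|μ|` as a regular positive Borel measure: the measure that represents the
positive functional `f ↦ sup { |μ(g)| : |g| ≤ f }`. -/
def absMeasure (μ : ComplexRadonMeasure d) : Measure (EuclideanSpace ℝ (Fin d)) :=
  NNRealRMK.rieszMeasure
    { toFun := μ.absFun
      map_add' := μ.absFun_add
      map_smul' := μ.absFun_smul }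

instance (μ : ComplexRadonMeasure d) : μ.absMeasure.Regular :=
  NNRealRMK.rieszMeasure_regular _

/-- A positive locally finite Borel measure `ν`, as the functional `φ ↦ ∫ φ dν`. -/
def ofMeasure (ν : Measure (EuclideanSpace ℝ (Fin d))) [IsFiniteMeasureOnCompacts ν] :
    ComplexRadonMeasure d where
  toLinearMap :=
    { toFun := fun φ => ∫ x, φ x ∂ν
      map_add' := fun φ ψ => by
        simpa using integral_add
          (φ.continuous.integrable_of_hasCompactSupport φ.hasCompactSupport)
          (ψ.continuous.integrable_of_hasCompactSupport ψ.hasCompactSupport)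
      map_smul' := fun c φ => by simpa using integral_const_mul c φ }
  bounded_on_compact := fun K hK => by
    refine ⟨ν.real K, fun φ M hφ hM => ?_⟩
    have h0 : ∫ x, φ x ∂ν = ∫ x in K, φ x ∂ν :=
      (setIntegral_eq_integral_of_forall_compl_eq_zero fun x hx =>
        image_eq_zero_of_notMem_tsupport fun h => hx (hφ h)).symm
    change ‖∫ x, φ x ∂ν‖ ≤ _
    rw [h0, mul_comm]
    exact norm_setIntegral_le_of_norm_le_const hK.measure_lt_top fun x _ => hM x

/-- The total variation `|μ|`, again as a Radon measure. -/
def abs (μ : ComplexRadonMeasure d) : ComplexRadonMeasure d :=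
  ofMeasure μ.absMeasure

/-- The integral `∫ f dμ` of an `f ∈ L¹(|μ|)`: the extension of `μ` by continuity from
`C_c(ℝ^d, ℂ)` to `L¹(|μ|)`, that is, the limit of `μ(g)` as `g ∈ C_c(ℝ^d, ℂ)` tends to `f` in the
norm of `L¹(|μ|)`. -/
def integral (μ : ComplexRadonMeasure d) (f : EuclideanSpace ℝ (Fin d) → ℂ) : ℂ :=
  limUnder (comap (fun g : C_c(EuclideanSpace ℝ (Fin d), ℂ) =>
    ∫⁻ x, ‖f x - g x‖ₑ ∂μ.absMeasure) (𝓝 0)) μ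

theorem enorm_le_lintegral (μ : ComplexRadonMeasure d)
    (g : C_c(EuclideanSpace ℝ (Fin d), ℂ)) : ‖μ g‖ₑ ≤ ∫⁻ x, ‖g x‖ₑ ∂μ.absMeasure := by
  have h := μ.le_absFun (f := ⟨⟨fun x => ‖g x‖₊, g.continuous.nnnorm⟩,
    g.hasCompactSupport.comp_left nnnorm_zero⟩) (g := g) fun x => le_rfl
  have h2 := NNRealRMK.lintegral_rieszMeasure
    (X := EuclideanSpace ℝ (Fin d))
    { toFun := μ.absFun
      map_add' := μ.absFun_add
      map_smul' := μ.absFun_smul } ⟨⟨fun x => ‖g x‖₊, g.continuous.nnnorm⟩,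
    g.hasCompactSupport.comp_left nnnorm_zero⟩
  refine (ENNReal.coe_le_coe.2 h).trans (le_of_eq ?_)
  exact h2.symm

/-- For `f ∈ L¹(|μ|)`, the limit that defines `∫ f dμ` is over a proper filter and exists. -/
theorem tendsto_integral (μ : ComplexRadonMeasure d) {f : EuclideanSpace ℝ (Fin d) → ℂ}
    (hf : Integrable f μ.absMeasure) :
    (comap (fun g : C_c(EuclideanSpace ℝ (Fin d), ℂ) =>
      ∫⁻ x, ‖f x - g x‖ₑ ∂μ.absMeasure) (𝓝 0)).NeBot ∧
    Tendsto μ (comap (fun g : C_c(EuclideanSpace ℝ (Fin d), ℂ) =>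
      ∫⁻ x, ‖f x - g x‖ₑ ∂μ.absMeasure) (𝓝 0)) (𝓝 (μ.integral f)) := by
  have hne : (comap (fun g : C_c(EuclideanSpace ℝ (Fin d), ℂ) =>
      ∫⁻ x, ‖f x - g x‖ₑ ∂μ.absMeasure) (𝓝 0)).NeBot := by
    rw [comap_neBot_iff]
    intro t ht
    obtain ⟨ε, hε, hεt⟩ := (ENNReal.nhds_zero_basis_Iic.mem_iff).1 ht
    obtain ⟨g, hgs, hg, hgc, -⟩ := hf.exists_hasCompactSupport_lintegral_sub_le hε.ne'
    exact ⟨⟨⟨g, hgc⟩, hgs⟩, hεt hg⟩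
  refine ⟨hne, ?_⟩
  refine tendsto_nhds_limUnder ?_
  have := hne.map μ
  refine CompleteSpace.complete (EMetric.cauchy_iff.2 ⟨this.ne, fun ε hε => ?_⟩)
  have hε2 : (0 : ENNReal) < ε / 2 := ENNReal.div_pos hε.ne' (by simp)
  refine ⟨_, image_mem_map (preimage_mem_comap (Iio_mem_nhds hε2)), ?_⟩
  rintro _ ⟨g, hg, rfl⟩ _ ⟨k, hk, rfl⟩
  rw [edist_eq_enorm_sub, ← map_sub]
  calc ‖μ (g - k)‖ₑ ≤ ∫⁻ x, ‖(g - k) x‖ₑ ∂μ.absMeasure := μ.enorm_le_lintegral _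
    _ ≤ ∫⁻ x, (‖f x - g x‖ₑ + ‖f x - k x‖ₑ) ∂μ.absMeasure := by
        refine lintegral_mono fun x => ?_
        have : (g - k) x = (f x - k x) - (f x - g x) := by simp
        rw [this, add_comm]
        exact enorm_sub_le
    _ = (∫⁻ x, ‖f x - g x‖ₑ ∂μ.absMeasure) + ∫⁻ x, ‖f x - k x‖ₑ ∂μ.absMeasure :=
        lintegral_add_left' (hf.aestronglyMeasurable.sub
          g.continuous.aestronglyMeasurable).enorm _
    _ < ε / 2 + ε / 2 := ENNReal.add_lt_add hg hk
    _ = ε := ENNReal.add_halves ε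

/-- `μ` is tempered: it agrees with some tempered distribution on the test functions. -/
def IsTempered (μ : ComplexRadonMeasure d) : Prop :=
  ∃ T : 𝓢'(EuclideanSpace ℝ (Fin d), ℂ),
    ∀ (φ : EuclideanSpace ℝ (Fin d) → ℂ) (hφ : ContDiff ℝ ∞ φ) (hc : HasCompactSupport φ),
      μ ⟨⟨φ, hφ.continuous⟩, hc⟩ = T (hc.toSchwartzMap hφ)

/-- `|ψ| ∈ L¹(|μ|)` for all Schwartz functions `ψ`. -/
def SchwartzIntegrable (μ : ComplexRadonMeasure d) : Prop :=
  ∀ ψ : 𝓢(EuclideanSpace ℝ (Fin d), ℂ), Integrable (fun x => ‖ψ x‖) μ.absMeasure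

/-- `μ` is strongly tempered: `|ψ| ∈ L¹(|μ|)` for all Schwartz functions `ψ`, and
`ψ ↦ ∫ ψ dμ` is a tempered distribution. -/
def IsStronglyTempered (μ : ComplexRadonMeasure d) : Prop :=
  μ.SchwartzIntegrable ∧
    ∃ T : 𝓢'(EuclideanSpace ℝ (Fin d), ℂ),
      ∀ ψ : 𝓢(EuclideanSpace ℝ (Fin d), ℂ), T ψ = μ.integral ψ

/-- `μ` is slowly increasing: `∫ 1 / (1 + |P|) d|μ| < ∞` for some complex polynomial `P`. -/
def IsSlowlyIncreasing (μ : ComplexRadonMeasure d) : Prop :=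
  ∃ P : MvPolynomial (Fin d) ℂ,
    ∫⁻ x, ENNReal.ofReal (1 / (1 + ‖MvPolynomial.eval (fun i => (x i : ℂ)) P‖)) ∂μ.absMeasure < ⊤

end ComplexRadonMeasure

end

/-!
The properties that involve only the positive measure `ν = |μ|` all say that `ν` has at most
polynomial growth, in the sense of Mathlib's `MeasureTheory.Measure.HasTemperateGrowth`:
`(1 + ‖x‖)⁻ⁿ` is `ν`-integrable for some `n`. Being slowly increasing is the same condition
(`isSlowlyIncreasing_iff`), since every polynomial is bounded by a power of `1 + ‖x‖`, and
`(1 + ∑ xᵢ²)ⁿ` dominates such a power.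

Temperate growth of `|μ|` makes `ψ ↦ ∫ ψ dμ` linear on Schwartz functions and bounded by a
Schwartz seminorm, because `‖∫ ψ dμ‖ ≤ ∫ ‖ψ‖ d|μ|` (`isStronglyTempered_of_hasTemperateGrowth`). As
`|μ|` is its own total variation (`absMeasure_abs`), this applies to `μ` and to `|μ|` alike.

Conversely, fix a bump function `φ ≥ 0` equal to `1` on the unit ball. By Tonelli's theorem it is
enough that `∫ φ(x - m) dν(x)` grows at most polynomially in `m`
(`hasTemperateGrowth_of_lintegral_translate_le`).
* If `ν` is tempered, a continuity estimate for the distribution gives this, because the Schwartz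
  seminorms of `φ(· - m)` grow polynomially (`TemperedDistribution.exists_norm_translate_le`).
* If all Schwartz functions are `ν`-integrable and the bound fails, there are `mⱼ` with
  `∫ φ(x - mⱼ) dν(x) > j 2ʲ (1 + ‖mⱼ‖)ʲ`. Then `∑ 2⁻ʲ (1 + ‖mⱼ‖)⁻ʲ φ(· - mⱼ)` is a Schwartz
  function with infinite integral (`exists_lintegral_translate_le_of_integrable`). This gliding
  hump replaces an appeal to completeness of the Schwartz space.

The example of a tempered measure that is not strongly tempered is `∂ᵢ (exp (i exp xᵢ)) dx`
(`oscillation`). It is the derivative of a bounded function, hence tempered, while its total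
variation `exp xᵢ dx` grows exponentially.
-/

/-! ### Translates of Schwartz functions -/

section Translates

variable {E F : Type*} [NormedAddCommGroup E] [NormedSpace ℝ E]
  [NormedAddCommGroup F] [NormedSpace ℝ F]

/-- Translating by `m` costs a factor `(1 + ‖m‖) ^ k` in the weight `‖x‖ ^ k`, since
`‖x‖ ≤ (1 + ‖m‖) * (1 + ‖x - m‖)`. -/
theorem SchwartzMap.exists_decay_translate_le (φ : 𝓢(E, F)) (k n : ℕ) :
    ∃ C, 0 ≤ C ∧ ∀ m x : E,
      ‖x‖ ^ k * ‖iteratedFDeriv ℝ n (fun y => φ (y - m)) x‖ ≤ C * (1 + ‖m‖) ^ k := by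
  refine ⟨2 ^ k * (Finset.Iic (k, n)).sup (fun m => SchwartzMap.seminorm ℝ m.1 m.2) φ,
    by positivity, fun m x => ?_⟩
  rw [iteratedFDeriv_comp_sub]
  have h := SchwartzMap.one_add_le_sup_seminorm_apply (𝕜 := ℝ) (m := (k, n)) le_rfl le_rfl φ (x - m)
  have hx : ‖x‖ ≤ (1 + ‖m‖) * (1 + ‖x - m‖) := by
    have := norm_add_le (x - m) m
    rw [sub_add_cancel] at this
    nlinarith [norm_nonneg m, norm_nonneg (x - m)]
  calc _ ≤ ((1 + ‖m‖) * (1 + ‖x - m‖)) ^ k * ‖iteratedFDeriv ℝ n φ (x - m)‖ := by gcongr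
    _ = (1 + ‖m‖) ^ k * ((1 + ‖x - m‖) ^ k * ‖iteratedFDeriv ℝ n φ (x - m)‖) := by
        rw [mul_pow, mul_assoc]
    _ ≤ (1 + ‖m‖) ^ k * _ := mul_le_mul_of_nonneg_left h (by positivity)
    _ = _ := mul_comm _ _

theorem SchwartzMap.exists_seminorm_translate_le (φ : 𝓢(E, ℂ)) (k n : ℕ) :
    ∃ C, 0 ≤ C ∧ ∀ m : E,
      SchwartzMap.seminorm ℂ k n (φ.compSubConstCLM ℂ m) ≤ C * (1 + ‖m‖) ^ k := by
  obtain ⟨C, hC, h⟩ := φ.exists_decay_translate_le k n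
  exact ⟨C, hC, fun m => SchwartzMap.seminorm_le_bound ℂ k n _ (by positivity) fun x => h m x⟩

/-- A tempered distribution is bounded by finitely many seminorms, so it grows at most polynomially
along the translates of a fixed Schwartz function. -/
theorem TemperedDistribution.exists_norm_translate_le (T : 𝓢'(E, ℂ)) (φ : 𝓢(E, ℂ)) :
    ∃ (C : ℝ) (N : ℕ), ∀ m : E, ‖T (φ.compSubConstCLM ℂ m)‖ ≤ C * (1 + ‖m‖) ^ N := by
  obtain ⟨s, C, -, hT⟩ := Seminorm.bound_of_continuous (schwartz_withSeminorms ℂ E ℂ)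
    ((normSeminorm ℂ ℂ).comp (T : 𝓢(E, ℂ) →ₗ[ℂ] ℂ)) (continuous_norm.comp (map_continuous T))
  choose D hD h using fun i : ℕ × ℕ => φ.exists_seminorm_translate_le i.1 i.2
  refine ⟨C * ∑ i ∈ s, D i, s.sup Prod.fst, fun m => ?_⟩
  calc ‖T (φ.compSubConstCLM ℂ m)‖
      ≤ C * (s.sup (schwartzSeminormFamily ℂ E ℂ)) (φ.compSubConstCLM ℂ m) := hT _
    _ ≤ C * ((∑ i ∈ s, D i) * (1 + ‖m‖) ^ s.sup Prod.fst) := by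
        gcongr
        refine Seminorm.finset_sup_apply_le
          (mul_nonneg (Finset.sum_nonneg fun i _ => hD i) (by positivity)) fun i hi => ?_
        calc _ ≤ D i * (1 + ‖m‖) ^ i.1 := h i m
          _ ≤ _ := by
            gcongr
            · exact Finset.sum_nonneg fun j _ => hD j
            · exact Finset.single_le_sum (fun j _ => hD j) hi
            · linarith [norm_nonneg m]
            · exact Finset.le_sup (f := Prod.fst) hi
    _ = _ := by ring

/-- For each `k` the weight of the `j`-th translate beats `(1 + ‖m j‖) ^ k` as soon as `j ≥ k`, so
the sum converges in every Schwartz seminorm, whatever the centres `m j` are. -/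
theorem SchwartzMap.exists_eq_tsum_translate (φ : 𝓢(E, ℂ)) (m : ℕ → E) :
    ∃ ψ : 𝓢(E, ℂ), ∀ x, HasSum
      (fun j => (((2 ^ j * (1 + ‖m j‖) ^ j)⁻¹ : ℝ) : ℂ) * φ (x - m j)) (ψ x) := by
  set c : ℕ → ℝ := fun j => (2 ^ j * (1 + ‖m j‖) ^ j)⁻¹ with hc
  have hc0 : ∀ j, 0 ≤ c j := fun j => by positivity
  have hone : ∀ j, 1 ≤ 1 + ‖m j‖ := fun j => by linarith [norm_nonneg (m j)]
  have hsum : ∀ k : ℕ, Summable fun j => c j * (1 + ‖m j‖) ^ k := by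
    intro k
    refine Summable.of_norm_bounded_eventually_nat (g := fun j => ((1 : ℝ) / 2) ^ j)
      summable_geometric_two ?_
    filter_upwards [eventually_ge_atTop k] with j hj
    rw [Real.norm_of_nonneg (mul_nonneg (hc0 j) (by positivity)), hc, one_div, inv_pow]
    simp only [mul_inv, mul_assoc]
    refine mul_le_of_le_one_right (by positivity) ?_
    rw [inv_mul_le_one₀ (by positivity)]
    exact pow_le_pow_right₀ (hone j) hj
  set f : ℕ → E → ℂ := fun j x => (c j : ℂ) * φ (x - m j) with hf
  have hd : ∀ j n x, iteratedFDeriv ℝ n (f j) x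
      = c j • iteratedFDeriv ℝ n (fun y => φ (y - m j)) x := by
    intro j n x
    have : f j = c j • fun y => φ (y - m j) := by ext y; simp [hf]
    rw [this]
    exact iteratedFDeriv_const_smul_apply
      (((φ.smooth n).comp (contDiff_id.sub contDiff_const)).contDiffAt)
  have hfs : ∀ j, ContDiff ℝ ∞ (f j) := fun j =>
    contDiff_const.mul ((φ.smooth ⊤).comp (contDiff_id.sub contDiff_const))
  choose D hD h using fun k n : ℕ => φ.exists_decay_translate_le k n
  have hb : ∀ k n j x, ‖x‖ ^ k * ‖iteratedFDeriv ℝ n (f j) x‖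
      ≤ D k n * (c j * (1 + ‖m j‖) ^ k) := by
    intro k n j x
    rw [hd, norm_smul, Real.norm_of_nonneg (hc0 j)]
    calc _ = c j * (‖x‖ ^ k * ‖iteratedFDeriv ℝ n (fun y => φ (y - m j)) x‖) := by ring
      _ ≤ c j * (D k n * (1 + ‖m j‖) ^ k) := mul_le_mul_of_nonneg_left (h k n _ _) (hc0 j)
      _ = _ := by ring
  have hb0 : ∀ n j x, ‖iteratedFDeriv ℝ n (f j) x‖ ≤ D 0 n * (c j * (1 + ‖m j‖) ^ 0) :=
    fun n j x => by simpa using hb 0 n j x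
  have hv : ∀ n : ℕ, Summable fun j => D 0 n * (c j * (1 + ‖m j‖) ^ 0) :=
    fun n => (hsum 0).mul_left _
  have hcd : ContDiff ℝ ∞ fun x => ∑' j, f j x :=
    contDiff_tsum (N := ⊤) hfs (fun n _ => hv n) fun n j x _ => hb0 n j x
  refine ⟨⟨fun x => ∑' j, f j x, hcd, fun k n => ?_⟩, fun x => ?_⟩
  · refine ⟨∑' j, D k n * (c j * (1 + ‖m j‖) ^ k), fun x => ?_⟩
    rw [iteratedFDeriv_tsum (N := ⊤) hfs (fun n _ => hv n) (fun n j x _ => hb0 n j x)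
      (mod_cast le_top)]
    have hs : Summable fun j => ‖iteratedFDeriv ℝ n (f j) x‖ :=
      (hv n).of_nonneg_of_le (fun _ => norm_nonneg _) fun j => hb0 n j x
    calc _ ≤ ‖x‖ ^ k * ∑' j, ‖iteratedFDeriv ℝ n (f j) x‖ := by
          gcongr
          exact norm_tsum_le_tsum_norm hs
      _ = ∑' j, ‖x‖ ^ k * ‖iteratedFDeriv ℝ n (f j) x‖ := tsum_mul_left.symm
      _ ≤ _ := (hs.mul_left _).tsum_le_tsum (fun j => hb k n j x) ((hsum k).mul_left _)
  · refine Summable.hasSum (Summable.of_norm_bounded (hv 0) fun j => ?_)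
    rw [← norm_iteratedFDeriv_zero (𝕜 := ℝ) (f := f j)]
    exact hb0 0 j x

end Translates

/-! ### Temperate growth from integrals of translates -/

section Measure

variable {E : Type*} [NormedAddCommGroup E] [NormedSpace ℝ E] [MeasurableSpace E]

/-- If every Schwartz function is integrable, then the integrals over the translates of a
nonnegative one grow at most polynomially: otherwise a rapidly decaying weighted sum of bad
translates would be a Schwartz function with infinite integral. -/
theorem exists_lintegral_translate_le_of_integrable (ν : Measure E)
    (hν : ∀ ψ : 𝓢(E, ℂ), Integrable (fun x => ‖ψ x‖) ν) (φ : 𝓢(E, ℂ))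
    (hφ : ∀ x, φ x = (‖φ x‖ : ℂ)) :
    ∃ (C : ℝ≥0) (N : ℕ), ∀ m : E, ∫⁻ x, ‖φ (x - m)‖ₑ ∂ν ≤ C * (1 + ‖m‖ₑ) ^ N := by
  by_contra! hcon
  -- The factor `2 ^ j` is the one in the weights of the sum; the factor `j` makes the integral of the
  -- sum at least `j` for every `j`.
  choose m hm using fun j : ℕ => hcon ((j * 2 ^ j : ℕ) : ℝ≥0) j
  obtain ⟨ψ, hψ⟩ := φ.exists_eq_tsum_translate m
  set c : ℕ → ℝ≥0 := fun j => (2 ^ j * (1 + ‖m j‖₊) ^ j)⁻¹ with hc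
  have hcoe : ∀ j, (2 ^ j * (1 + ‖m j‖) ^ j)⁻¹ = (c j : ℝ) := fun j => by simp [hc]
  have hle : ∀ j x, (c j : ℝ) * ‖φ (x - m j)‖ ≤ ‖ψ x‖ := by
    intro j x
    have h1 := Complex.hasSum_re (hψ x)
    have h2 : ∀ i, ((((2 ^ i * (1 + ‖m i‖) ^ i)⁻¹ : ℝ) : ℂ) * φ (x - m i)).re
        = c i * ‖φ (x - m i)‖ := fun i => by
      rw [hcoe, hφ, ← Complex.ofReal_mul, Complex.ofReal_re]
      simp
    simp_rw [h2] at h1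
    exact (le_hasSum h1 j fun i _ => by positivity).trans (Complex.re_le_norm _)
  have hle' : ∀ j : ℕ, (j : ENNReal) ≤ ∫⁻ x, ‖ψ x‖ₑ ∂ν := by
    intro j
    have h3 : (c j : ENNReal) * ∫⁻ x, ‖φ (x - m j)‖ₑ ∂ν ≤ ∫⁻ x, ‖ψ x‖ₑ ∂ν := by
      rw [← lintegral_const_mul' _ _ ENNReal.coe_ne_top]
      refine lintegral_mono fun x => ?_
      have : c j * ‖φ (x - m j)‖₊ ≤ ‖ψ x‖₊ := by exact_mod_cast hle j x
      simpa [enorm_eq_nnnorm] using ENNReal.coe_le_coe.2 this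
    refine le_trans ?_ ((mul_le_mul_right (hm j).le _).trans h3)
    have : (j : ℝ≥0) = c j * (((j * 2 ^ j : ℕ) : ℝ≥0) * (1 + ‖m j‖₊) ^ j) := by
      simp only [hc]
      push_cast
      field_simp
    have := congrArg ((↑) : ℝ≥0 → ENNReal) this
    push_cast at this
    rw [this]
    simp [enorm_eq_nnnorm]
  have hfin : ∫⁻ x, ‖ψ x‖ₑ ∂ν ≠ ⊤ := by
    have := (hν ψ).2
    simpa [HasFiniteIntegral] using this.ne
  obtain ⟨n, hn⟩ := ENNReal.exists_nat_gt hfin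
  exact absurd (hle' n) (not_le.2 hn)

/-- Integrating the bounds over all translates against Lebesgue measure shows that polynomial growth
of the masses near `m`, as `m` varies, is enough for temperate growth of the measure. -/
theorem hasTemperateGrowth_of_lintegral_translate_le [BorelSpace E]
    [FiniteDimensional ℝ E] (ν : Measure E)
    [SFinite ν] (φ : E → ℂ) (hφ : Continuous φ) (hφ1 : ∀ x, ‖x‖ ≤ 1 → φ x = 1) (C : ℝ≥0)
    (N : ℕ) (h : ∀ m : E, ∫⁻ x, ‖φ (x - m)‖ₑ ∂ν ≤ C * (1 + ‖m‖ₑ) ^ N) :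
    ν.HasTemperateGrowth := by
  let vol : Measure E := Measure.addHaar
  -- Enough decay to absorb the growth `(1 + ‖m‖) ^ N` and to be integrable in `m` afterwards.
  set K := N + vol.integrablePower with hK
  have hint := vol.integrable_pow_neg_integrablePower
  let w : E → ENNReal := fun m => ENNReal.ofReal ((1 + ‖m‖) ^ (-(K : ℝ)))
  have hpos : ∀ x : E, 1 + ‖x‖ ≠ 0 := fun x => by positivity
  have hw : Continuous w := by
    refine ENNReal.continuous_ofReal.comp ?_
    exact (continuous_const.add continuous_norm).rpow_const fun x => Or.inl (hpos x)
  have hupper : ∫⁻ m, w m * ∫⁻ x, ‖φ (x - m)‖ₑ ∂ν ∂vol < ⊤ := by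
    calc _ ≤ ∫⁻ m, C * ENNReal.ofReal ((1 + ‖m‖) ^ (-(vol.integrablePower : ℝ))) ∂vol := by
          refine lintegral_mono fun m => ?_
          refine (mul_le_mul_right (h m) _).trans (le_of_eq ?_)
          have h1 : (1 + ‖m‖ₑ) = ENNReal.ofReal (1 + ‖m‖) := by
            rw [ENNReal.ofReal_add zero_le_one (norm_nonneg _), ofReal_norm, ENNReal.ofReal_one]
          rw [h1, mul_left_comm, ← ENNReal.ofReal_pow (p := 1 + ‖m‖) (by positivity),
            ← ENNReal.ofReal_mul (p := (1 + ‖m‖) ^ (-(K : ℝ))) (by positivity),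
            ← Real.rpow_natCast, ← Real.rpow_add (by positivity), hK]
          congr 3
          push_cast
          ring
      _ = C * ∫⁻ m, ENNReal.ofReal ((1 + ‖m‖) ^ (-(vol.integrablePower : ℝ))) ∂vol :=
          lintegral_const_mul' _ _ ENNReal.coe_ne_top
      _ < ⊤ := ENNReal.mul_lt_top ENNReal.coe_lt_top hint.lintegral_lt_top
  have hswap : ∫⁻ m, w m * ∫⁻ x, ‖φ (x - m)‖ₑ ∂ν ∂vol
      = ∫⁻ x, ∫⁻ m, w m * ‖φ (x - m)‖ₑ ∂vol ∂ν := by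
    rw [lintegral_lintegral_swap]
    · refine lintegral_congr fun m => (lintegral_const_mul' _ _ ENNReal.ofReal_ne_top).symm
    · exact ((hw.comp continuous_snd).measurable.mul
        (hφ.comp (continuous_fst.sub continuous_snd)).enorm.measurable).aemeasurable
  -- On the unit ball around `x`, where `φ (x - m) = 1`, the weights at `m` and `x` are comparable.
  have hlower : ∀ x, ENNReal.ofReal (2 ^ (-(K : ℝ))) * vol (Metric.closedBall 0 1) *
      w x ≤ ∫⁻ m, w m * ‖φ (x - m)‖ₑ ∂vol := by
    intro x
    calc _ = ∫⁻ m in Metric.closedBall x 1, ENNReal.ofReal (2 ^ (-(K : ℝ))) * w x ∂vol := by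
          rw [setLIntegral_const, Measure.addHaar_closedBall_center vol x]
          ring
      _ ≤ ∫⁻ m in Metric.closedBall x 1, w m * ‖φ (x - m)‖ₑ ∂vol := by
          refine setLIntegral_mono' Metric.isClosed_closedBall.measurableSet fun m hm => ?_
          rw [mem_closedBall_iff_norm'] at hm
          rw [hφ1 _ hm, enorm_one, mul_one,
            ← ENNReal.ofReal_mul (p := 2 ^ (-(K : ℝ))) (by positivity), ← Real.mul_rpow (by positivity) (by positivity)]
          refine ENNReal.ofReal_le_ofReal
            (Real.rpow_le_rpow_of_nonpos (by positivity) ?_ (by simp))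
          have := norm_sub_norm_le m x
          rw [norm_sub_rev] at this
          linarith [norm_nonneg x]
      _ ≤ _ := setLIntegral_le_lintegral _ _
  refine ⟨K, ?_, ?_⟩
  · exact ((continuous_const.add continuous_norm).rpow_const
      fun x => Or.inl (hpos x)).aestronglyMeasurable
  · have h2 : ENNReal.ofReal (2 ^ (-(K : ℝ))) * vol (Metric.closedBall 0 1) * ∫⁻ x, w x ∂ν < ⊤ := by
      rw [← lintegral_const_mul _ hw.measurable]
      refine lt_of_le_of_lt (lintegral_mono hlower) ?_
      rw [← hswap]
      exact hupper
    have h3 : ENNReal.ofReal (2 ^ (-(K : ℝ))) * vol (Metric.closedBall 0 1) ≠ 0 :=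
      mul_ne_zero (by simp) (Metric.measure_closedBall_pos _ _ one_pos).ne'
    rw [HasFiniteIntegral]
    refine lt_of_le_of_lt (le_of_eq (lintegral_congr fun x => ?_))
      (ENNReal.lt_top_of_mul_ne_top_right h2.ne h3)
    exact Real.enorm_of_nonneg (by positivity)

theorem exists_smooth_bump (E : Type*) [NormedAddCommGroup E] [NormedSpace ℝ E]
    [FiniteDimensional ℝ E] :
    ∃ φ : E → ℂ, ContDiff ℝ ∞ φ ∧ HasCompactSupport φ ∧ (∀ x, φ x = (‖φ x‖ : ℂ)) ∧
      ∀ x, ‖x‖ ≤ 1 → φ x = 1 := by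
  let b : ContDiffBump (0 : E) := ⟨1, 2, one_pos, one_lt_two⟩
  refine ⟨fun x => (b x : ℂ), Complex.ofRealCLM.contDiff.comp b.contDiff,
    b.hasCompactSupport.comp_left Complex.ofReal_zero, fun x => ?_, fun x hx => ?_⟩
  · change ((b x : ℝ) : ℂ) = (‖((b x : ℝ) : ℂ)‖ : ℂ)
    rw [Complex.norm_real, Real.norm_of_nonneg b.nonneg]
  · change ((b x : ℝ) : ℂ) = 1
    rw [b.one_of_mem_closedBall (by simpa using hx), Complex.ofReal_one]

end Measure

namespace ComplexRadonMeasure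

variable {d : ℕ}

/-! ### The total variation of a positive measure -/

section TotalVariation

theorem integral_absMeasure (μ : ComplexRadonMeasure d)
    (f : C_c(EuclideanSpace ℝ (Fin d), ℝ≥0)) :
    ∫ x, (f x : ℝ) ∂μ.absMeasure = μ.absFun f :=
  NNRealRMK.integral_rieszMeasure _ f

/-- For a positive measure the supremum defining the total variation is attained at `g = f`. -/
theorem absFun_ofMeasure (ν : Measure (EuclideanSpace ℝ (Fin d))) [IsFiniteMeasureOnCompacts ν]
    (f : C_c(EuclideanSpace ℝ (Fin d), ℝ≥0)) :
    ((ofMeasure ν).absFun f : ℝ) = ∫ x, (f x : ℝ) ∂ν := by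
  have hfc : Continuous fun x => (f x : ℝ) := NNReal.continuous_coe.comp f.continuous
  have hfs : HasCompactSupport fun x => (f x : ℝ) := f.hasCompactSupport.comp_left NNReal.coe_zero
  have hint : Integrable (fun x => (f x : ℝ)) ν := hfc.integrable_of_hasCompactSupport hfs
  have hnn : 0 ≤ ∫ x, (f x : ℝ) ∂ν := integral_nonneg fun x => (f x).2
  apply le_antisymm
  · refine NNReal.coe_le_coe.2 ((ofMeasure ν).absFun_le (a := ⟨∫ x, (f x : ℝ) ∂ν, hnn⟩)
      fun g hg => ?_)
    change ‖∫ x, g x ∂ν‖ ≤ ∫ x, (f x : ℝ) ∂ν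
    exact norm_integral_le_of_norm_le hint (Eventually.of_forall fun x => by exact_mod_cast hg x)
  · let g : C_c(EuclideanSpace ℝ (Fin d), ℂ) :=
      ⟨⟨fun x => ((f x : ℝ) : ℂ), Complex.continuous_ofReal.comp hfc⟩,
        hfs.comp_left Complex.ofReal_zero⟩
    have h := (ofMeasure ν).le_absFun (f := f) (g := g) fun x => by
      change ‖((f x : ℝ) : ℂ)‖₊ ≤ f x
      simp
    refine le_trans (le_of_eq ?_) (NNReal.coe_le_coe.2 h)
    change _ = ‖∫ x, ((f x : ℝ) : ℂ) ∂ν‖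
    rw [integral_complex_ofReal, Complex.norm_real, Real.norm_of_nonneg hnn]

theorem absMeasure_ofMeasure (ν : Measure (EuclideanSpace ℝ (Fin d))) [ν.Regular] :
    (ofMeasure ν).absMeasure = ν :=
  Measure.ext_of_integral_eq_on_compactlySupported_nnreal fun f => by
    rw [integral_absMeasure, absFun_ofMeasure]

theorem absMeasure_abs (μ : ComplexRadonMeasure d) : μ.abs.absMeasure = μ.absMeasure :=
  absMeasure_ofMeasure _

end TotalVariation

/-! ### The integral against a complex Radon measure -/

section Integral

variable (μ : ComplexRadonMeasure d)

/-- The integral can be computed along any approximation of `f` by compactly supported continuous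
functions in `L¹(|μ|)`. -/
theorem integral_eq_of_tendsto {ι : Type*} {l : Filter ι} [l.NeBot]
    {f : EuclideanSpace ℝ (Fin d) → ℂ} (hf : Integrable f μ.absMeasure)
    {u : ι → C_c(EuclideanSpace ℝ (Fin d), ℂ)} {z : ℂ}
    (hu : Tendsto (fun i => ∫⁻ x, ‖f x - u i x‖ₑ ∂μ.absMeasure) l (𝓝 0))
    (hz : Tendsto (fun i => μ (u i)) l (𝓝 z)) : μ.integral f = z :=
  tendsto_nhds_unique ((μ.tendsto_integral hf).2.comp (tendsto_comap_iff.2 hu)) hz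

theorem integral_coe (g : C_c(EuclideanSpace ℝ (Fin d), ℂ)) : μ.integral g = μ g :=
  μ.integral_eq_of_tendsto (l := (pure () : Filter Unit)) (u := fun _ => g)
    (g.continuous.integrable_of_hasCompactSupport g.hasCompactSupport) (by simp)
    tendsto_const_nhds

theorem integral_add {f₁ f₂ : EuclideanSpace ℝ (Fin d) → ℂ} (h₁ : Integrable f₁ μ.absMeasure)
    (h₂ : Integrable f₂ μ.absMeasure) :
    μ.integral (fun x => f₁ x + f₂ x) = μ.integral f₁ + μ.integral f₂ := by
  obtain ⟨hne₁, ht₁⟩ := μ.tendsto_integral h₁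
  obtain ⟨hne₂, ht₂⟩ := μ.tendsto_integral h₂
  refine μ.integral_eq_of_tendsto (h₁.add h₂) (u := fun p => p.1 + p.2)
    (l := comap (fun g : C_c(EuclideanSpace ℝ (Fin d), ℂ) =>
        ∫⁻ x, ‖f₁ x - g x‖ₑ ∂μ.absMeasure) (𝓝 0) ×ˢ
      comap (fun g : C_c(EuclideanSpace ℝ (Fin d), ℂ) =>
        ∫⁻ x, ‖f₂ x - g x‖ₑ ∂μ.absMeasure) (𝓝 0)) ?_ ?_
  · have hc : ∀ f : EuclideanSpace ℝ (Fin d) → ℂ,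
        Tendsto (fun g : C_c(EuclideanSpace ℝ (Fin d), ℂ) => ∫⁻ x, ‖f x - g x‖ₑ ∂μ.absMeasure)
          (comap (fun g : C_c(EuclideanSpace ℝ (Fin d), ℂ) =>
            ∫⁻ x, ‖f x - g x‖ₑ ∂μ.absMeasure) (𝓝 0)) (𝓝 0) := fun f => tendsto_comap
    have h := ((hc f₁).comp tendsto_fst).add ((hc f₂).comp tendsto_snd)
    rw [add_zero] at h
    refine tendsto_of_tendsto_of_tendsto_of_le_of_le tendsto_const_nhds h
      (fun _ => zero_le) fun p => ?_
    change _ ≤ (∫⁻ x, ‖f₁ x - p.1 x‖ₑ ∂μ.absMeasure) + ∫⁻ x, ‖f₂ x - p.2 x‖ₑ ∂μ.absMeasure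
    refine le_trans ?_ (le_of_eq (lintegral_add_left' (h₁.aestronglyMeasurable.sub
      p.1.continuous.aestronglyMeasurable).enorm _))
    refine lintegral_mono fun x => ?_
    have : f₁ x + f₂ x - (p.1 + p.2) x = (f₁ x - p.1 x) + (f₂ x - p.2 x) := by
      rw [CompactlySupportedContinuousMap.add_apply]; ring
    change ‖f₁ x + f₂ x - (p.1 + p.2) x‖ₑ ≤ ‖f₁ x - p.1 x‖ₑ + ‖f₂ x - p.2 x‖ₑ
    rw [this]
    exact enorm_add_le _ _
  · simp_rw [map_add]
    exact (ht₁.comp tendsto_fst).add (ht₂.comp tendsto_snd)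

theorem integral_smul (c : ℂ) {f : EuclideanSpace ℝ (Fin d) → ℂ}
    (hf : Integrable f μ.absMeasure) :
    μ.integral (fun x => c • f x) = c • μ.integral f := by
  obtain ⟨hne, ht⟩ := μ.tendsto_integral hf
  refine μ.integral_eq_of_tendsto (hf.smul c) (u := fun g => c • g)
    (l := comap (fun g : C_c(EuclideanSpace ℝ (Fin d), ℂ) =>
        ∫⁻ x, ‖f x - g x‖ₑ ∂μ.absMeasure) (𝓝 0)) ?_ ?_
  · have h := ENNReal.Tendsto.const_mul (a := ‖c‖ₑ) (tendsto_comap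
      (f := fun g : C_c(EuclideanSpace ℝ (Fin d), ℂ) => ∫⁻ x, ‖f x - g x‖ₑ ∂μ.absMeasure)
      (x := 𝓝 0)) (Or.inr enorm_ne_top)
    rw [mul_zero] at h
    refine h.congr fun g => ?_
    rw [← lintegral_const_mul' _ _ enorm_ne_top]
    refine lintegral_congr fun x => ?_
    rw [CompactlySupportedContinuousMap.smul_apply, Pi.smul_apply, ← smul_sub, enorm_smul]
  · simp_rw [map_smul]
    exact ht.const_smul c

theorem enorm_integral_le {f : EuclideanSpace ℝ (Fin d) → ℂ} (hf : Integrable f μ.absMeasure) :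
    ‖μ.integral f‖ₑ ≤ ∫⁻ x, ‖f x‖ₑ ∂μ.absMeasure := by
  obtain ⟨hne, ht⟩ := μ.tendsto_integral hf
  have h := (tendsto_const_nhds (x := ∫⁻ x, ‖f x‖ₑ ∂μ.absMeasure)).add (tendsto_comap
      (f := fun g : C_c(EuclideanSpace ℝ (Fin d), ℂ) => ∫⁻ x, ‖f x - g x‖ₑ ∂μ.absMeasure)
      (x := 𝓝 0))
  rw [add_zero] at h
  refine le_of_tendsto_of_tendsto' ht.enorm h fun g => (μ.enorm_le_lintegral g).trans ?_
  rw [← lintegral_add_left' hf.aestronglyMeasurable.enorm]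
  refine lintegral_mono fun x => ?_
  have : g x = f x - (f x - g x) := by ring
  nth_rw 1 [this]
  exact enorm_sub_le

theorem norm_integral_le {f : EuclideanSpace ℝ (Fin d) → ℂ} (hf : Integrable f μ.absMeasure) :
    ‖μ.integral f‖ ≤ ∫ x, ‖f x‖ ∂μ.absMeasure := by
  rw [integral_norm_eq_lintegral_enorm hf.aestronglyMeasurable, ← toReal_enorm]
  exact ENNReal.toReal_mono hf.2.ne (μ.enorm_integral_le hf)

end Integral

/-! ### Tempered and strongly tempered measures -/

section Tempered

variable {μ : ComplexRadonMeasure d}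

theorem isStronglyTempered_of_hasTemperateGrowth (h : μ.absMeasure.HasTemperateGrowth) :
    μ.IsStronglyTempered := by
  refine ⟨fun ψ => ψ.integrable.norm, ContinuousLinearMap.toPointwiseConvergenceCLM _ _ _ _
    (SchwartzMap.mkCLMtoNormedSpace (σ := RingHom.id ℂ) (fun ψ => μ.integral ψ)
    (fun f g => μ.integral_add f.integrable g.integrable)
    (fun a f => μ.integral_smul a f.integrable) ?_), fun ψ => rfl⟩
  set p := μ.absMeasure.integrablePower
  set A := ∫ x, (1 + ‖x‖) ^ (-(p : ℝ)) ∂μ.absMeasure with hA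
  have hA0 : 0 ≤ A := integral_nonneg fun x => by positivity
  -- `‖ψ x‖` is at most a constant times `(1 + ‖x‖) ^ (-p)`, with a constant controlled by the
  -- seminorms of orders `(0, 0)` and `(p, 0)`.
  refine ⟨{(0, 0), (p, 0)}, 2 ^ p * A * 2, by positivity, fun ψ => ?_⟩
  have h1 := SchwartzMap.integral_pow_mul_iteratedFDeriv_le ℂ μ.absMeasure ψ 0 0
  simp only [pow_zero, one_mul, norm_iteratedFDeriv_zero, zero_add] at h1
  have h2 : ∀ i ∈ ({(0, 0), (p, 0)} : Finset (ℕ × ℕ)), SchwartzMap.seminorm ℂ i.1 i.2 ψ ≤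
      (({(0, 0), (p, 0)} : Finset (ℕ × ℕ)).sup
        (schwartzSeminormFamily ℂ (EuclideanSpace ℝ (Fin d)) ℂ)) ψ := fun i hi =>
    Seminorm.le_finset_sup_apply (p := schwartzSeminormFamily ℂ (EuclideanSpace ℝ (Fin d)) ℂ) hi
  have h3 := h2 (0, 0) (by simp)
  have h4 := h2 (p, 0) (by simp)
  calc ‖μ.integral ψ‖ ≤ ∫ x, ‖ψ x‖ ∂μ.absMeasure := μ.norm_integral_le ψ.integrable
    _ ≤ 2 ^ p * A * (SchwartzMap.seminorm ℂ 0 0 ψ + SchwartzMap.seminorm ℂ p 0 ψ) := h1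
    _ ≤ 2 ^ p * A * (_ + _) := mul_le_mul_of_nonneg_left (add_le_add h3 h4) (by positivity)
    _ = _ := by ring

theorem IsStronglyTempered.isTempered (h : μ.IsStronglyTempered) : μ.IsTempered := by
  obtain ⟨-, T, hT⟩ := h
  refine ⟨T, fun φ hφ hc => ?_⟩
  rw [hT, ← μ.integral_coe]
  rfl

theorem hasTemperateGrowth_of_schwartzIntegrable (h : μ.SchwartzIntegrable) :
    μ.absMeasure.HasTemperateGrowth := by
  obtain ⟨φ, hφ, hc, hnn, h1⟩ := exists_smooth_bump (EuclideanSpace ℝ (Fin d))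
  obtain ⟨C, N, hb⟩ := exists_lintegral_translate_le_of_integrable μ.absMeasure h
    (hc.toSchwartzMap hφ) hnn
  exact hasTemperateGrowth_of_lintegral_translate_le _ φ hφ.continuous h1 C N hb

/-- For a positive measure no cancellation can occur: the distribution tested against a translated
bump equals the integral of its modulus. -/
theorem hasTemperateGrowth_of_isTempered_ofMeasure (ν : Measure (EuclideanSpace ℝ (Fin d)))
    [IsFiniteMeasureOnCompacts ν] (h : (ofMeasure ν).IsTempered) : ν.HasTemperateGrowth := by
  obtain ⟨T, hT⟩ := h
  obtain ⟨φ, hφ, hc, hnn, h1⟩ := exists_smooth_bump (EuclideanSpace ℝ (Fin d))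
  obtain ⟨C, N, hb⟩ := T.exists_norm_translate_le (hc.toSchwartzMap hφ)
  refine hasTemperateGrowth_of_lintegral_translate_le ν φ hφ.continuous h1 C.toNNReal N
    fun m => ?_
  have hφm : ContDiff ℝ ∞ fun x => φ (x - m) := hφ.comp (contDiff_id.sub contDiff_const)
  have hcm : HasCompactSupport fun x => φ (x - m) :=
    hc.comp_homeomorph (Homeomorph.subRight m)
  have hint : Integrable (fun x => φ (x - m)) ν :=
    hφm.continuous.integrable_of_hasCompactSupport hcm
  have hTm : T ((hc.toSchwartzMap hφ).compSubConstCLM ℂ m) = ∫ x, φ (x - m) ∂ν :=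
    (hT _ hφm hcm).symm
  have hbm := hb m
  have hint2 : ∫ x, φ (x - m) ∂ν = ((∫ x, ‖φ (x - m)‖ ∂ν : ℝ) : ℂ) := by
    rw [← integral_complex_ofReal]
    exact integral_congr_ae (Eventually.of_forall fun x => hnn _)
  rw [hTm, hint2, Complex.norm_real,
    Real.norm_of_nonneg (integral_nonneg fun x => norm_nonneg _)] at hbm
  rw [← ofReal_integral_norm_eq_lintegral_enorm hint]
  refine (ENNReal.ofReal_le_ofReal hbm).trans (le_of_eq ?_)
  rw [ENNReal.ofReal_mul' (by positivity), ENNReal.ofReal_pow (by positivity),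
    ENNReal.ofReal_add zero_le_one (norm_nonneg _), ofReal_norm, ENNReal.ofReal_one]
  rfl

end Tempered

/-! ### Slowly increasing measures -/

section SlowlyIncreasing

theorem exists_norm_eval_le (P : MvPolynomial (Fin d) ℂ) :
    ∃ (C : ℝ) (N : ℕ), 0 ≤ C ∧ ∀ x : EuclideanSpace ℝ (Fin d),
      ‖MvPolynomial.eval (fun i => (x i : ℂ)) P‖ ≤ C * (1 + ‖x‖) ^ N := by
  induction P using MvPolynomial.induction_on with
  | C a => exact ⟨‖a‖, 0, norm_nonneg _, fun x => by simp⟩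
  | add p q hp hq =>
    obtain ⟨C₁, N₁, hC₁, h₁⟩ := hp
    obtain ⟨C₂, N₂, hC₂, h₂⟩ := hq
    refine ⟨C₁ + C₂, max N₁ N₂, by positivity, fun x => ?_⟩
    have h1 : 1 ≤ 1 + ‖x‖ := by linarith [norm_nonneg x]
    rw [map_add, add_mul]
    refine (norm_add_le _ _).trans (add_le_add ((h₁ x).trans ?_) ((h₂ x).trans ?_))
    · gcongr
      exact le_max_left _ _
    · gcongr
      exact le_max_right _ _
  | mul_X p i hp =>
    obtain ⟨C, N, hC, h⟩ := hp
    refine ⟨C, N + 1, hC, fun x => ?_⟩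
    rw [map_mul, MvPolynomial.eval_X, norm_mul, Complex.norm_real, pow_succ, ← mul_assoc]
    have hx : ‖x i‖ ≤ 1 + ‖x‖ := (PiLp.norm_apply_le x i).trans (by linarith)
    exact mul_le_mul (h x) hx (norm_nonneg _) (by positivity)

theorem isSlowlyIncreasing_iff (μ : ComplexRadonMeasure d) :
    μ.IsSlowlyIncreasing ↔ μ.absMeasure.HasTemperateGrowth := by
  have hpos : ∀ x : EuclideanSpace ℝ (Fin d), 1 + ‖x‖ ≠ 0 := fun x => by positivity
  constructor
  · rintro ⟨P, hP⟩
    obtain ⟨C, N, hC, hb⟩ := exists_norm_eval_le P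
    refine ⟨N, ((continuous_const.add continuous_norm).rpow_const
      fun x => Or.inl (hpos x)).aestronglyMeasurable, ?_⟩
    have hle : ∀ x : EuclideanSpace ℝ (Fin d), ‖(1 + ‖x‖) ^ (-(N : ℝ))‖ₑ ≤
        ENNReal.ofReal (1 + C) *
          ENNReal.ofReal (1 / (1 + ‖MvPolynomial.eval (fun i => (x i : ℂ)) P‖)) := by
      intro x
      have h1 : 1 ≤ (1 + ‖x‖) ^ N := one_le_pow₀ (by linarith [norm_nonneg x])
      rw [← ENNReal.ofReal_mul (by positivity), Real.enorm_of_nonneg (by positivity),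
        Real.rpow_neg (by positivity), Real.rpow_natCast]
      refine ENNReal.ofReal_le_ofReal ?_
      rw [mul_one_div, le_div_iff₀ (by positivity), inv_mul_le_iff₀ (by positivity)]
      nlinarith [hb x]
    refine lt_of_le_of_lt (lintegral_mono hle) ?_
    rw [lintegral_const_mul' _ _ ENNReal.ofReal_ne_top]
    exact ENNReal.mul_lt_top ENNReal.ofReal_lt_top hP
  · rintro ⟨n, hn⟩
    refine ⟨(1 + ∑ i, MvPolynomial.X i ^ 2) ^ n, ?_⟩
    have hle : ∀ x : EuclideanSpace ℝ (Fin d), ENNReal.ofReal (1 / (1 + ‖MvPolynomial.eval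
        (fun i => (x i : ℂ)) ((1 + ∑ i, MvPolynomial.X i ^ 2) ^ n)‖)) ≤
          ENNReal.ofReal (2 ^ n) * ENNReal.ofReal ((1 + ‖x‖) ^ (-(n : ℝ))) := by
      intro x
      have h1 : MvPolynomial.eval (fun i => (x i : ℂ)) ((1 + ∑ i, MvPolynomial.X i ^ 2) ^ n)
          = (((1 + ‖x‖ ^ 2) ^ n : ℝ) : ℂ) := by
        rw [EuclideanSpace.real_norm_sq_eq]
        simp
      rw [h1, Complex.norm_real, Real.norm_of_nonneg (by positivity),
        ← ENNReal.ofReal_mul (by positivity), Real.rpow_neg (by positivity), Real.rpow_natCast]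
      refine ENNReal.ofReal_le_ofReal ?_
      rw [← div_eq_mul_inv, div_le_div_iff₀ (by positivity) (by positivity), one_mul]
      calc (1 + ‖x‖) ^ n ≤ (2 * (1 + ‖x‖ ^ 2)) ^ n := by
            gcongr
            nlinarith [sq_nonneg (‖x‖ - 1), norm_nonneg x]
        _ = 2 ^ n * (1 + ‖x‖ ^ 2) ^ n := mul_pow _ _ _
        _ ≤ _ := by gcongr; linarith
    refine lt_of_le_of_lt (lintegral_mono hle) ?_
    rw [lintegral_const_mul' _ _ ENNReal.ofReal_ne_top]
    exact ENNReal.mul_lt_top ENNReal.ofReal_lt_top hn.lintegral_lt_top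

end SlowlyIncreasing

/-! ### A tempered measure that is not strongly tempered -/

section Oscillation

open scoped LineDeriv

/-- The Radon measure `f dx` with continuous density `f` against Lebesgue measure. -/
noncomputable def ofDensity (f : EuclideanSpace ℝ (Fin d) → ℂ) (hf : Continuous f) :
    ComplexRadonMeasure d where
  toLinearMap :=
    { toFun := fun φ => ∫ x, f x * φ x
      map_add' := fun φ ψ => by
        have h : ∀ φ : C_c(EuclideanSpace ℝ (Fin d), ℂ), Integrable fun x => f x * φ x :=
          fun φ => (hf.mul φ.continuous).integrable_of_hasCompactSupport
            φ.hasCompactSupport.mul_left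
        simpa [mul_add] using MeasureTheory.integral_add (h φ) (h ψ)
      map_smul' := fun c φ => by
        simpa [mul_left_comm] using integral_const_mul c fun x => f x * φ x }
  bounded_on_compact := fun K hK => by
    refine ⟨∫ x in K, ‖f x‖, fun φ M hφ hM => ?_⟩
    have h0 : ∫ x, f x * φ x = ∫ x in K, f x * φ x :=
      (setIntegral_eq_integral_of_forall_compl_eq_zero fun x hx => by
        rw [image_eq_zero_of_notMem_tsupport fun h => hx (hφ h), mul_zero]).symm
    change ‖∫ x, f x * φ x‖ ≤ _
    rw [h0, ← integral_mul_const]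
    refine norm_integral_le_of_norm_le ((hf.norm.continuousOn.integrableOn_compact hK).mul_const M)
      (Eventually.of_forall fun x => ?_)
    rw [norm_mul]
    exact mul_le_mul_of_nonneg_left (hM x) (norm_nonneg _)

/-- The phase `x ↦ exp (i exp xᵢ)`: a bounded smooth function with exponentially growing
derivative in the direction `i`. -/
noncomputable def phase (i : Fin d) (x : EuclideanSpace ℝ (Fin d)) : ℂ :=
  Complex.exp (Complex.I * (Real.exp (x i) : ℂ))

theorem continuous_phase (i : Fin d) : Continuous (phase i) := by
  unfold phase; fun_prop

theorem norm_phase (i : Fin d) (x : EuclideanSpace ℝ (Fin d)) : ‖phase i x‖ = 1 := by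
  rw [phase, mul_comm, Complex.norm_exp_ofReal_mul_I]

theorem hasFDerivAt_phase (i : Fin d) (x : EuclideanSpace ℝ (Fin d)) :
    HasFDerivAt (phase i) (phase i x • Complex.I • Complex.ofRealCLM.comp
      (Real.exp (x i) • (EuclideanSpace.proj i : EuclideanSpace ℝ (Fin d) →L[ℝ] ℝ))) x := by
  have h1 : HasFDerivAt (fun y : EuclideanSpace ℝ (Fin d) => Real.exp (y i)) _ x :=
    (EuclideanSpace.proj i : EuclideanSpace ℝ (Fin d) →L[ℝ] ℝ).hasFDerivAt.exp
  exact ((Complex.ofRealCLM.hasFDerivAt.comp x h1).const_mul Complex.I).cexp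

theorem fderiv_phase (i : Fin d) (x : EuclideanSpace ℝ (Fin d)) :
    fderiv ℝ (phase i) x (EuclideanSpace.single i 1) =
      Complex.I * (Real.exp (x i) : ℂ) * phase i x := by
  rw [(hasFDerivAt_phase i x).fderiv]
  simp
  ring

/-- The Radon measure `∂ᵢ (exp (i exp xᵢ)) dx`. Its density has modulus `exp xᵢ`, but as the
derivative of a bounded function it is a tempered distribution. -/
noncomputable def oscillation (i : Fin d) : ComplexRadonMeasure d :=
  ofDensity (fun x => Complex.I * (Real.exp (x i) : ℂ) * phase i x)
    (by have := continuous_phase i; fun_prop)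

theorem isTempered_oscillation (i : Fin d) : (oscillation i).IsTempered := by
  have hc := continuous_phase i
  have hmem : MemLp (phase i) ⊤ volume := memLp_top_of_bound hc.aestronglyMeasurable 1
    (Eventually.of_forall fun x => (norm_phase i x).le)
  refine ⟨∂_{EuclideanSpace.single i (1 : ℝ)} (Lp.toTemperedDistribution hmem.toLp),
    fun φ hφ hs => ?_⟩
  have hφ1 : ContDiff ℝ 1 φ := hφ.of_le (by simp)
  have hdφ : Continuous fun x => fderiv ℝ φ x (EuclideanSpace.single i 1) :=
    (hφ1.continuous_fderiv one_ne_zero).clm_apply continuous_const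
  have hds : HasCompactSupport fun x => fderiv ℝ φ x (EuclideanSpace.single i 1) :=
    hs.fderiv_apply ℝ _
  have hparts := integral_mul_fderiv_eq_neg_fderiv_mul_of_integrable (μ := volume)
    (f := phase i) (g := φ) (v := EuclideanSpace.single i (1 : ℝ))
    (by
      simp_rw [fderiv_phase]
      exact Continuous.integrable_of_hasCompactSupport (by fun_prop) hs.mul_left)
    (Continuous.integrable_of_hasCompactSupport (by fun_prop) hds.mul_left)
    (Continuous.integrable_of_hasCompactSupport (by fun_prop) hs.mul_left)
    (fun x _ => (hasFDerivAt_phase i x).differentiableAt)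
    (fun x _ => (hφ1.differentiable one_ne_zero).differentiableAt)
  simp_rw [fderiv_phase] at hparts
  rw [TemperedDistribution.lineDerivOp_apply_apply, Lp.toTemperedDistribution_apply]
  change ∫ x, Complex.I * (Real.exp (x i) : ℂ) * phase i x * φ x = _
  rw [← neg_eq_iff_eq_neg.2 hparts, ← MeasureTheory.integral_neg]
  refine integral_congr_ae ?_
  filter_upwards [hmem.coeFn_toLp] with x hx
  rw [hx, neg_apply, SchwartzMap.lineDerivOp_apply_eq_fderiv, smul_eq_mul, neg_mul,
    mul_comm]
  rfl

/-- Multiplying a test function by the conjugate phase undoes the cancellation, so the total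
variation of a translated bump grows exponentially with the translation. -/
theorem ofReal_exp_mul_le_lintegral_oscillation (i : Fin d) (φ : EuclideanSpace ℝ (Fin d) → ℂ)
    (hφ : Continuous φ) (hs : HasCompactSupport φ) (hnn : ∀ x, φ x = (‖φ x‖ : ℂ)) (t : ℝ) :
    ENNReal.ofReal (Real.exp t * ∫ x, Real.exp (x i) * ‖φ x‖) ≤
      ∫⁻ x, ‖φ (x - EuclideanSpace.single i t)‖ₑ ∂(oscillation i).absMeasure := by
  set m : EuclideanSpace ℝ (Fin d) := EuclideanSpace.single i t with hm
  have hph := continuous_phase i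
  have hph0 : ∀ x, phase i x ≠ 0 := fun x => Complex.exp_ne_zero _
  let g : C_c(EuclideanSpace ℝ (Fin d), ℂ) :=
    ⟨⟨fun x => (Complex.I * phase i x)⁻¹ * φ (x - m),
      (Continuous.inv₀ (by fun_prop) fun x => mul_ne_zero Complex.I_ne_zero (hph0 x)).mul
        (by fun_prop)⟩,
      (hs.comp_homeomorph (Homeomorph.subRight m)).mul_left⟩
  have h := (oscillation i).enorm_le_lintegral g
  have hg : ∀ x, ‖g x‖ₑ = ‖φ (x - m)‖ₑ := fun x => by
    change ‖(Complex.I * phase i x)⁻¹ * φ (x - m)‖ₑ = _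
    rw [← ofReal_norm, ← ofReal_norm, norm_mul, norm_inv, norm_mul, norm_phase]
    simp
  simp_rw [hg] at h
  refine le_trans (le_of_eq ?_) h
  have hval : (oscillation i) g = ((Real.exp t * ∫ x, Real.exp (x i) * ‖φ x‖ : ℝ) : ℂ) := by
    change ∫ x, Complex.I * (Real.exp (x i) : ℂ) * phase i x *
      ((Complex.I * phase i x)⁻¹ * φ (x - m)) = _
    rw [← MeasureTheory.integral_const_mul, ← integral_complex_ofReal,
      ← integral_sub_right_eq_self
        (fun x => ((Real.exp t * (Real.exp (x i) * ‖φ x‖) : ℝ) : ℂ)) m]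
    refine integral_congr_ae (Eventually.of_forall fun x => ?_)
    have hx : (Real.exp (x i) : ℂ) = Real.exp t * Real.exp ((x - m) i) := by
      rw [← Complex.ofReal_mul, ← Real.exp_add]
      simp [hm]
    simp only
    rw [hx, Complex.ofReal_mul, Complex.ofReal_mul, ← hnn (x - m)]
    have := hph0 x
    field_simp
  rw [hval, ← ofReal_norm, Complex.norm_real, Real.norm_of_nonneg]
  exact mul_nonneg (Real.exp_pos t).le (integral_nonneg fun x => by positivity)

theorem not_isStronglyTempered_oscillation (i : Fin d) : ¬ (oscillation i).IsStronglyTempered := by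
  rintro ⟨hint, -⟩
  obtain ⟨φ, hφ, hs, hnn, h1⟩ := exists_smooth_bump (EuclideanSpace ℝ (Fin d))
  obtain ⟨C, N, hb⟩ := exists_lintegral_translate_le_of_integrable _ hint
    (hs.toSchwartzMap hφ) hnn
  set A := ∫ x : EuclideanSpace ℝ (Fin d), Real.exp (x i) * ‖φ x‖ with hA
  have hφc := hφ.continuous
  have hA0 : 0 < A := by
    refine Continuous.integral_pos_of_hasCompactSupport_nonneg_nonzero (x := 0) (by fun_prop)
      hs.norm.mul_left (fun x => by positivity) ?_
    simp [h1 0]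
  -- Integrability would make the exponential growth polynomial.
  have hle : ∀ t : ℝ, 0 ≤ t → Real.exp t * A ≤ C * (1 + t) ^ N := by
    intro t ht
    have h := (ofReal_exp_mul_le_lintegral_oscillation i φ hφc hs hnn t).trans (hb _)
    have h2 : (C : ENNReal) * (1 + ‖(EuclideanSpace.single i t : EuclideanSpace ℝ (Fin d))‖ₑ) ^ N
        = ENNReal.ofReal (C * (1 + t) ^ N) := by
      rw [← ofReal_norm, PiLp.norm_single, Real.norm_of_nonneg ht,
        ENNReal.ofReal_mul (by positivity), ENNReal.ofReal_pow (by positivity),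
        ENNReal.ofReal_add zero_le_one ht, ENNReal.ofReal_one, ENNReal.ofReal_coe_nnreal]
    rw [h2] at h
    exact (ENNReal.ofReal_le_ofReal_iff (by positivity)).1 h
  have hlim := (Real.tendsto_pow_mul_exp_neg_atTop_nhds_zero N).comp
    (tendsto_atTop_add_const_left atTop (1 : ℝ) tendsto_id)
  have hlim2 := (hlim.const_mul (C * Real.exp 1))
  rw [mul_zero] at hlim2
  refine absurd hA0 (not_lt.2 (ge_of_tendsto hlim2 ?_))
  filter_upwards [eventually_ge_atTop 0] with t ht
  have := hle t ht
  simp only [Function.comp, id]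
  calc A = Real.exp t * A * Real.exp (-t) := by
        rw [mul_right_comm, ← Real.exp_add]; simp
    _ ≤ C * (1 + t) ^ N * Real.exp (-t) := by gcongr
    _ = C * (1 + t) ^ N * (Real.exp 1 * Real.exp (-(1 + t))) := by
        rw [← Real.exp_add]; ring_nf
    _ = _ := by ring

end Oscillation

end ComplexRadonMeasure

theorem mainTheorem3 (d : ℕ) :
    (∀ μ : ComplexRadonMeasure d,
      List.TFAE [
        μ.IsSlowlyIncreasing,
        μ.abs.IsStronglyTempered,
        μ.abs.IsTempered,
        ∀ ψ : 𝓢(EuclideanSpace ℝ (Fin d), ℂ), Integrable (fun x => ‖ψ x‖) μ.absMeasure,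
        μ.IsStronglyTempered] ∧
      (μ.IsStronglyTempered → μ.IsTempered)) ∧
    (1 ≤ d → ∃ μ : ComplexRadonMeasure d, μ.IsTempered ∧ ¬ μ.IsStronglyTempered) := by
  refine ⟨fun μ => ⟨?_, fun h => h.isTempered⟩, fun hd => ?_⟩
  · tfae_have 1 → 2 := fun h => by
      refine ComplexRadonMeasure.isStronglyTempered_of_hasTemperateGrowth ?_
      rw [μ.absMeasure_abs]
      exact μ.isSlowlyIncreasing_iff.1 h
    tfae_have 2 → 3 := fun h => h.isTempered
    tfae_have 3 → 1 := fun h => μ.isSlowlyIncreasing_iff.2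
      (ComplexRadonMeasure.hasTemperateGrowth_of_isTempered_ofMeasure _ h)
    tfae_have 1 → 5 := fun h => ComplexRadonMeasure.isStronglyTempered_of_hasTemperateGrowth
      (μ.isSlowlyIncreasing_iff.1 h)
    tfae_have 5 → 4 := fun h => h.1
    tfae_have 4 → 1 := fun h => μ.isSlowlyIncreasing_iff.2
      (ComplexRadonMeasure.hasTemperateGrowth_of_schwartzIntegrable h)
    tfae_finish
  · exact ⟨ComplexRadonMeasure.oscillation ⟨0, hd⟩,
      ComplexRadonMeasure.isTempered_oscillation _,
      ComplexRadonMeasure.not_isStronglyTempered_oscillation _⟩
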